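/- Let $n\in\{2,3\}$. A point of $\mathbb{Z}^n$ is primitive if the gcd of its coordinates is $1$; for primitive $v$, written as a column vector, put $q(v)=vv^t$, an element of the space of real symmetric $n\times n$ matrices. Let the Voronoi polyhedron $\Pi$ be the closed convex hull of all points $q(v)$ with $v\in\mathbb{Z}^n$ primitive. A Voronoi cone $\sigma$ is the closed cone $\{tx : t\ge 0,\ x\in F\}$ over a nonempty proper face $F$ of $\Pi$ (the intersection of $\Pi$ with a supporting hyperplane); it is top-dimensional if it spans the space of symmetric $n\times n$ matrices. Write $\operatorname{Vert}\sigma$ for the set of primitive points $v\in\mathbb{Z}^n$ such that $q(v)$ is a vertex of $F$. A modular symbol $\mathbf v=[v_1,\dots,v_n]$ is given by primitive points $v_1,\dots,v_n\in\mathbb{Z}^n$. Put $\|\mathbf v\|=|\det(v_1,\dots,v_n)|$ and $b(\mathbf v)=\sum_{i=1}^n v_iv_i^t$, and define the set of candidates $$\operatorname{Cand}\mathbf v=\Bigl\{w\in\mathbb{Z}^n \Bigm| w\ne 0 \text{ and } w=\sum_{i=1}^n q_iv_i \text{ with } q_i\in\mathbb{Q},\ 0\le |q_i|<1\Bigr\}.$$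 **Theorem.** Let $n=2$ or $n=3$. If $\mathbf v$ is a modular symbol with $\|\mathbf v\|>1$ and $\sigma$ is a top-dimensional Voronoi cone with $b(\mathbf v)\in\sigma$, then $$\operatorname{Cand}\mathbf v\cap\operatorname{Vert}\sigma\neq\varnothing .$$ -/

import Mathlib

namespace Voronoi

/-- The real vector space of symmetric `n × n` matrices, as a subspace of all matrices. -/
def symm (n : ℕ) : Submodule ℝ (Matrix (Fin n) (Fin n) ℝ) where
  carrier := {x | x.IsSymm}
  add_mem' := fun ha hb => ha.add hb
  zero_mem' := Matrix.isSymm_zero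
  smul_mem' := fun c _ hx => hx.smul c

/-- A point of `ℤⁿ` is primitive if the gcd of its coordinates is `1`. -/
def IsPrimitive {n : ℕ} (v : Fin n → ℤ) : Prop :=
  Finset.univ.gcd v = 1

/-- The rank-one quadratic form `q(v) = v vᵗ`, as a real symmetric matrix. -/
def q {n : ℕ} (v : Fin n → ℤ) : Matrix (Fin n) (Fin n) ℝ :=
  Matrix.of fun i j => (v i : ℝ) * (v j : ℝ)

/-- The Voronoi polyhedron: the closed convex hull of the points `q(v)`, `v` primitive. -/
def polyhedron (n : ℕ) : Set (Matrix (Fin n) (Fin n) ℝ) :=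
  closure (convexHull ℝ {x | ∃ v : Fin n → ℤ, IsPrimitive v ∧ x = q v})

/-- A Voronoi cone, given by the face of the Voronoi polyhedron that generates it: a nonempty
proper face, cut out by a supporting hyperplane. -/
structure Cone (n : ℕ) where
  /-- The face of the Voronoi polyhedron generating the cone. -/
  face : Set (Matrix (Fin n) (Fin n) ℝ)
  isExposed : IsExposed ℝ (polyhedron n) face
  nonempty : face.Nonempty
  proper : face ≠ polyhedron n

/-- The points of a Voronoi cone: the closed cone over the generating face. -/
def Cone.toSet {n : ℕ} (σ : Cone n) : Set (Matrix (Fin n) (Fin n) ℝ) :=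
  {y | ∃ t : ℝ, 0 ≤ t ∧ ∃ x ∈ σ.face, y = t • x}

/-- A Voronoi cone is top-dimensional if it spans the space of symmetric matrices. -/
def Cone.IsTop {n : ℕ} (σ : Cone n) : Prop :=
  Submodule.span ℝ σ.toSet = symm n

/-- The primitive points `v` such that `q(v)` is a vertex of the face generating the cone. -/
def Cone.vertices {n : ℕ} (σ : Cone n) : Set (Fin n → ℤ) :=
  {v | IsPrimitive v ∧ q v ∈ σ.face.extremePoints ℝ}

/-- A modular symbol `[v₁, …, vₙ]`, given by a tuple of primitive points. The notions `norm`, `b`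
and `cand` below do not change when the `vᵢ` are permuted or multiplied by signs. -/
structure ModularSymbol (n : ℕ) where
  /-- The points `v₁, …, vₙ`. -/
  vec : Fin n → Fin n → ℤ
  primitive : ∀ i, IsPrimitive (vec i)

/-- `‖v‖ = |det (v₁, …, vₙ)|`, the `vᵢ` being the columns. -/
def ModularSymbol.norm {n : ℕ} (v : ModularSymbol n) : ℤ :=
  |(Matrix.of fun i j => v.vec j i).det|

/-- `b(v) = ∑ vᵢ vᵢᵗ`. -/
def ModularSymbol.b {n : ℕ} (v : ModularSymbol n) : Matrix (Fin n) (Fin n) ℝ :=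
  ∑ i, q (v.vec i)

/-- The candidates of `v`: the nonzero integral points `w = ∑ cᵢ vᵢ` with `cᵢ` rational and
`0 ≤ |cᵢ| < 1`. -/
def ModularSymbol.cand {n : ℕ} (v : ModularSymbol n) : Set (Fin n → ℤ) :=
  {w | w ≠ 0 ∧ ∃ c : Fin n → ℚ, (∀ i, 0 ≤ |c i| ∧ |c i| < 1) ∧
    ∀ k, (w k : ℚ) = ∑ i, c i * (v.vec i k : ℚ)}

end Voronoi

/-!
The face generating `σ` is cut out of `Π` by `tr (A x) = 1`, where `A` is a positive semidefinite
form with minimum `1` on the nonzero integral points, and the primitive `w` with `wᵗ A w = 1` give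
vertices of that face. Suppose that none of them is a candidate. The form `C = b(v)⁻¹` takes at
`w` the sum of squares of the coordinates of `w` with respect to `v₁, …, vₙ`, so it is at least `1`
wherever `w` is not a candidate. Hence `C ≥ A` on the vertices of the face, thus on all of `σ`, and
`tr (A b(v)) ≤ tr (C b(v)) = n`. The inequality of arithmetic and geometric means then gives
`det A · ‖v‖² = det A · det b(v) ≤ 1`. On the other hand Minkowski's theorem bounds `det A` below by
`4⁻ⁿ` times the square of the volume of the unit ball, so `vol · ‖v‖ ≤ 2ⁿ`, which fails for
`n = 2, 3` as soon as `‖v‖ ≥ 2`.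
-/

namespace Voronoi

open Matrix MeasureTheory Filter

section RealForms

variable {ι : Type*} [Fintype ι]

theorem exists_eq_transpose_mul_self {A : Matrix ι ι ℝ} (hA : A.PosSemidef) :
    ∃ B : Matrix ι ι ℝ, A = Bᵀ * B := by
  classical
  open scoped MatrixOrder in
  obtain ⟨B, hB⟩ := CStarAlgebra.nonneg_iff_eq_star_mul_self.1 hA.nonneg
  exact ⟨B, by rw [hB, star_eq_conjTranspose, conjTranspose_eq_transpose_of_trivial]⟩

theorem dotProduct_transpose_mul_self_mulVec {κ R : Type*} [Fintype κ] [CommSemiring R]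
    (B : Matrix κ ι R) (x : ι → R) :
    x ⬝ᵥ (Bᵀ * B) *ᵥ x = ∑ i, (B *ᵥ x) i ^ 2 := by
  rw [← mulVec_mulVec, dotProduct_mulVec, vecMul_transpose]
  simp only [dotProduct, sq]

theorem trace_mul_vecMulVec_self {R : Type*} [CommSemiring R] (A : Matrix ι ι R) (x : ι → R) :
    (A * vecMulVec x x).trace = x ⬝ᵥ A *ᵥ x := by
  rw [mul_vecMulVec, trace_vecMulVec, dotProduct_comm]

theorem trace_mul_transpose_mul_self {κ R : Type*} [Fintype κ] [CommSemiring R]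
    (A : Matrix ι ι R) (C : Matrix κ ι R) :
    (A * (Cᵀ * C)).trace = (C * A * Cᵀ).trace := by
  rw [← Matrix.mul_assoc, trace_mul_comm, Matrix.mul_assoc]

theorem posSemidef_mul_mul_transpose {κ : Type*} [Finite κ] {A : Matrix ι ι ℝ}
    (hA : A.PosSemidef) (C : Matrix κ ι ℝ) : (C * A * Cᵀ).PosSemidef := by
  simpa only [conjTranspose_eq_transpose_of_trivial] using hA.mul_mul_conjTranspose_same C

theorem trace_mul_nonneg {A B : Matrix ι ι ℝ} (hA : A.PosSemidef) (hB : B.PosSemidef) :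
    0 ≤ (A * B).trace := by
  obtain ⟨C, rfl⟩ := exists_eq_transpose_mul_self hB
  rw [trace_mul_transpose_mul_self]
  exact (posSemidef_mul_mul_transpose hA C).trace_nonneg

theorem trace_mul_pos {A B : Matrix ι ι ℝ} (hA : A.PosSemidef) (hA₀ : A ≠ 0) (hB : B.PosDef) :
    0 < (A * B).trace := by
  classical
  refine (trace_mul_nonneg hA hB.posSemidef).lt_of_ne' fun h => hA₀ ?_
  obtain ⟨C, rfl⟩ := exists_eq_transpose_mul_self hB.posSemidef
  have hC : IsUnit C := isUnit_of_mul_isUnit_right hB.isUnit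
  have hCT : IsUnit Cᵀ := (isUnit_transpose C).2 hC
  rwa [trace_mul_transpose_mul_self, (posSemidef_mul_mul_transpose hA C).trace_eq_zero_iff,
    hCT.mul_left_eq_zero, hC.mul_right_eq_zero] at h

theorem det_le_trace_div_card_pow [DecidableEq ι] {A : Matrix ι ι ℝ} (hA : A.PosSemidef) :
    A.det ≤ (A.trace / Fintype.card ι) ^ Fintype.card ι := by
  cases isEmpty_or_nonempty ι
  · simp
  have hcard : (Fintype.card ι : ℝ) ≠ 0 := Nat.cast_ne_zero.2 Fintype.card_ne_zero
  have hev := hA.eigenvalues_nonneg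
  rw [hA.1.det_eq_prod_eigenvalues, hA.1.trace_eq_sum_eigenvalues]
  simp only [RCLike.ofReal_real_eq_id, id]
  have amgm := Real.geom_mean_le_arith_mean_weighted Finset.univ
    (fun _ : ι => (Fintype.card ι : ℝ)⁻¹) hA.1.eigenvalues (fun _ _ => by positivity)
    (by simp [hcard]) fun i _ => hev i
  rw [← Finset.mul_sum, inv_mul_eq_div] at amgm
  calc ∏ i, hA.1.eigenvalues i
      = (∏ i, hA.1.eigenvalues i ^ (Fintype.card ι : ℝ)⁻¹) ^ Fintype.card ι := by
        rw [← Finset.prod_pow]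
        exact Finset.prod_congr rfl fun i _ =>
          (Real.rpow_inv_natCast_pow (hev i) Fintype.card_ne_zero).symm
    _ ≤ _ := pow_le_pow_left₀ (Finset.prod_nonneg fun i _ => Real.rpow_nonneg (hev i) _) amgm _

theorem det_mul_det_le_trace_mul_div_card_pow [DecidableEq ι] {A B : Matrix ι ι ℝ}
    (hA : A.PosSemidef) (hB : B.PosSemidef) :
    A.det * B.det ≤ ((A * B).trace / Fintype.card ι) ^ Fintype.card ι := by
  obtain ⟨C, rfl⟩ := exists_eq_transpose_mul_self hB
  have hdet : (C * A * Cᵀ).det = A.det * (Cᵀ * C).det := by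
    simp only [det_mul, det_transpose]
    ring
  rw [trace_mul_transpose_mul_self, ← hdet]
  exact det_le_trace_div_card_pow (posSemidef_mul_mul_transpose hA C)

theorem exists_eq_smul_vecMulVec_self {A : Matrix ι ι ℝ} (hA : A.PosSemidef) {u : ι → ℝ}
    (h : ∀ z, z ⬝ᵥ u = 0 → z ⬝ᵥ A *ᵥ z = 0) : ∃ s : ℝ, A = s • vecMulVec u u := by
  classical
  obtain ⟨B, rfl⟩ := exists_eq_transpose_mul_self hA
  have hker : ∀ z, z ⬝ᵥ u = 0 → B *ᵥ z = 0 := fun z hz => by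
    have hsum := h z hz
    rw [dotProduct_transpose_mul_self_mulVec,
      Finset.sum_eq_zero_iff_of_nonneg fun _ _ => sq_nonneg _] at hsum
    exact funext fun i => pow_eq_zero_iff two_ne_zero |>.1 (hsum i (Finset.mem_univ i))
  have hproj : ∀ z, B *ᵥ z = (z ⬝ᵥ u / (u ⬝ᵥ u)) • B *ᵥ u := fun z => by
    rw [← sub_eq_zero, ← mulVec_smul, ← mulVec_sub]
    refine hker _ ?_
    rw [sub_dotProduct, smul_dotProduct, smul_eq_mul, div_mul_cancel_of_imp, sub_self]
    intro hu
    rw [dotProduct_self_eq_zero.1 hu, dotProduct_zero]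
  have hB : B = vecMulVec ((u ⬝ᵥ u)⁻¹ • B *ᵥ u) u := by
    ext i j
    have := congrFun (hproj (Pi.single j 1)) i
    rw [mulVec_single_one, single_one_dotProduct] at this
    rw [vecMulVec_apply, Pi.smul_apply, smul_eq_mul, mul_right_comm, ← div_eq_inv_mul]
    exact this
  refine ⟨((u ⬝ᵥ u)⁻¹ • B *ᵥ u) ⬝ᵥ ((u ⬝ᵥ u)⁻¹ • B *ᵥ u), ?_⟩
  generalize (u ⬝ᵥ u)⁻¹ • B *ᵥ u = y at hB
  rw [hB, transpose_vecMulVec, vecMulVec_mul_vecMulVec, vecMulVec_smul]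

theorem vecMulVec_self_mem_extremePoints {F : Set (Matrix ι ι ℝ)}
    (hF : ∀ x ∈ F, x.PosSemidef) {A : Matrix ι ι ℝ} (hA : ∀ x ∈ F, (A * x).trace = 1) {u : ι → ℝ}
    (hu : vecMulVec u u ∈ F) : vecMulVec u u ∈ F.extremePoints ℝ := by
  refine mem_extremePoints_iff_left.2 ⟨hu, ?_⟩
  rintro x hx y hy ⟨a, b, ha, hb, -, hab⟩
  obtain ⟨s, rfl⟩ := exists_eq_smul_vecMulVec_self (hF x hx) (u := u) fun z hz => by
    have hx₀ : 0 ≤ z ⬝ᵥ x *ᵥ z := (hF x hx).dotProduct_mulVec_nonneg z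
    have hy₀ : 0 ≤ z ⬝ᵥ y *ᵥ z := (hF y hy).dotProduct_mulVec_nonneg z
    have hz₀ : a * (z ⬝ᵥ x *ᵥ z) + b * (z ⬝ᵥ y *ᵥ z) = 0 := by
      have := congrArg (fun M : Matrix ι ι ℝ => z ⬝ᵥ M *ᵥ z) hab
      simpa only [vecMulVec_mulVec, add_mulVec, smul_mulVec, dotProduct_add, dotProduct_smul,
        dotProduct_comm u z, hz, MulOpposite.op_zero, zero_smul, dotProduct_zero,
        smul_eq_mul] using this
    nlinarith [mul_nonneg hb.le hy₀]
  have hs : s = 1 := by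
    have := hA _ hx
    rwa [Matrix.mul_smul, trace_smul, hA _ hu, smul_eq_mul, mul_one] at this
  rw [hs, one_smul]

theorem exists_isSymm_forall_eq_trace_mul (l : Matrix ι ι ℝ →ₗ[ℝ] ℝ) :
    ∃ A : Matrix ι ι ℝ, A.IsSymm ∧ ∀ x : Matrix ι ι ℝ, x.IsSymm → l x = (A * x).trace := by
  classical
  let D : Matrix ι ι ℝ := of fun i j => l (single j i 1)
  have hD : ∀ x, l x = (D * x).trace := fun x => by
    conv_lhs => rw [matrix_eq_sum_single x, Finset.sum_comm]
    simp only [map_sum, trace, diag, mul_apply, D, of_apply]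
    refine Finset.sum_congr rfl fun i _ => Finset.sum_congr rfl fun j _ => ?_
    rw [← mul_one (x j i), ← smul_eq_mul, ← smul_single, map_smul, smul_eq_mul, smul_eq_mul,
      mul_one, mul_comm]
  refine ⟨(2⁻¹ : ℝ) • (D + Dᵀ), ?_, fun x hx => ?_⟩
  · rw [IsSymm, transpose_smul, transpose_add, transpose_transpose, add_comm]
  · have hDT : (Dᵀ * x).trace = (D * x).trace := by
      rw [← trace_transpose, transpose_mul, transpose_transpose, hx.eq, trace_mul_comm]
    rw [smul_mul, trace_smul, add_mul, trace_add, hDT, hD, smul_eq_mul]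
    ring

theorem dotProduct_inv_mul_transpose_mulVec [DecidableEq ι] {R : Type*} [CommRing R]
    {V : Matrix ι ι R} (hV : IsUnit V.det) (c : ι → R) :
    (V *ᵥ c) ⬝ᵥ (V * Vᵀ)⁻¹ *ᵥ (V *ᵥ c) = c ⬝ᵥ c := by
  have hVT : IsUnit Vᵀ.det := by rwa [det_transpose]
  rw [Matrix.mul_inv_rev, mulVec_mulVec, Matrix.mul_assoc, nonsing_inv_mul _ hV, Matrix.mul_one,
    dotProduct_mulVec, ← vecMul_transpose, vecMul_vecMul, mul_nonsing_inv _ hVT, vecMul_one]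

end RealForms

section IntegralPoints

variable {ι : Type*}

/-- The integral point `w`, viewed in `ℝ^ι`. -/
def realVec (w : ι → ℤ) : ι → ℝ := fun i => w i

theorem tendsto_realVec_cofinite_cocompact [Finite ι] :
    Tendsto (realVec : (ι → ℤ) → ι → ℝ) cofinite (cocompact (ι → ℝ)) := by
  rw [← coprodᵢ_cofinite, ← coprodᵢ_cocompact]
  exact Tendsto.pi_map_coprodᵢ fun _ => Int.tendsto_coe_cofinite

variable [Fintype ι]

/-- The value `wᵗ A w` at the integral point `w` of the quadratic form with matrix `A`. -/
def value (A : Matrix ι ι ℝ) (w : ι → ℤ) : ℝ := realVec w ⬝ᵥ A *ᵥ realVec w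

theorem value_nonneg {A : Matrix ι ι ℝ} (hA : A.PosSemidef) (w : ι → ℤ) : 0 ≤ value A w :=
  hA.dotProduct_mulVec_nonneg (realVec w)

theorem value_add (A B : Matrix ι ι ℝ) (w : ι → ℤ) : value (A + B) w = value A w + value B w := by
  rw [value, add_mulVec, dotProduct_add]; rfl

theorem value_smul (c : ℝ) (A : Matrix ι ι ℝ) (w : ι → ℤ) : value (c • A) w = c * value A w := by
  rw [value, smul_mulVec, dotProduct_smul]; rfl

theorem finite_setOf_value_le {A : Matrix ι ι ℝ} (hA : A.PosDef) (R : ℝ) :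
    {w : ι → ℤ | value A w ≤ R}.Finite := by
  classical
  obtain ⟨B, rfl⟩ := exists_eq_transpose_mul_self hA.posSemidef
  have hB : IsUnit B.det := (isUnit_iff_isUnit_det B).1 (isUnit_of_mul_isUnit_right hA.isUnit)
  let K : Set (ι → ℝ) := (B⁻¹ *ᵥ ·) '' Set.Icc (fun _ => -√R) (fun _ => √R)
  have hK : IsCompact K := isCompact_Icc.image (by fun_prop)
  have hfin : (realVec ⁻¹' K).Finite := by
    simpa using tendsto_realVec_cofinite_cocompact hK.compl_mem_cocompact
  refine hfin.subset fun w hw => ⟨B *ᵥ realVec w, ?_, ?_⟩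
  · have hBw : ∀ i, |(B *ᵥ realVec w) i| ≤ √R := fun i => by
      rw [Set.mem_ofPred_eq, value, dotProduct_transpose_mul_self_mulVec] at hw
      have hle := Finset.single_le_sum (f := fun i => (B *ᵥ realVec w) i ^ 2)
        (fun _ _ => sq_nonneg _) (Finset.mem_univ i)
      exact Real.abs_le_sqrt (hle.trans hw)
    exact ⟨fun i => (abs_le.1 (hBw i)).1, fun i => (abs_le.1 (hBw i)).2⟩
  · dsimp only
    rw [mulVec_mulVec, nonsing_inv_mul _ hB, one_mulVec]

theorem posSemidef_of_forall_value_nonneg {A : Matrix ι ι ℝ} (hA : A.IsSymm)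
    (h : ∀ w, 0 ≤ value A w) : A.PosSemidef := by
  refine .of_dotProduct_mulVec_nonneg hA fun x => ?_
  have hdense : DenseRange (Pi.map fun (_ : ι) (r : ℚ) => (r : ℝ)) :=
    DenseRange.piMap fun _ => Rat.denseRange_cast
  refine isClosed_property hdense (p := fun x => 0 ≤ x ⬝ᵥ A *ᵥ x)
    (isClosed_le continuous_const (by fun_prop)) (fun r => ?_) x
  obtain ⟨d, hd⟩ := IsLocalization.exist_integer_multiples_of_finite (nonZeroDivisors ℤ) r
  choose w hw using hd
  have hw' : realVec w = ((d : ℤ) : ℝ) • Pi.map (fun (_ : ι) (r : ℚ) => (r : ℝ)) r := by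
    ext i
    have := congrArg (Rat.cast : ℚ → ℝ) (hw i)
    simpa [realVec, zsmul_eq_mul] using this
  have hd₀ : ((d : ℤ) : ℝ) ≠ 0 := Int.cast_ne_zero.2 (nonZeroDivisors.coe_ne_zero d)
  have hvalue := h w
  rw [value, hw', mulVec_smul, dotProduct_smul, smul_dotProduct, smul_smul, smul_eq_mul] at hvalue
  exact nonneg_of_mul_nonneg_right hvalue (mul_self_pos.2 hd₀)

theorem exists_ne_zero_mulVec_realVec_mem [DecidableEq ι] {B : Matrix ι ι ℝ} (hB : IsUnit B.det)
    {s : Set (ι → ℝ)} (hsymm : ∀ x ∈ s, -x ∈ s) (hconvex : Convex ℝ s)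
    (hvol : ENNReal.ofReal |B.det| * 2 ^ Fintype.card ι < volume s) :
    ∃ w : ι → ℤ, w ≠ 0 ∧ B *ᵥ realVec w ∈ s := by
  let b : Module.Basis ι ℝ (ι → ℝ) :=
    (Pi.basisFun ℝ ι).map (B.toLinearEquiv (Pi.basisFun ℝ ι) hB)
  have hb : ∀ j, b j = B.col j := fun j => by simp [b, toLin_eq_toLin', col]
  have hfund : volume (ZSpan.fundamentalDomain b) = ENNReal.ofReal |B.det| := by
    have hbB : (of b)ᵀ = B := by
      ext i j
      simp only [transpose_apply, of_apply, hb, col]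
    rw [ZSpan.volume_fundamentalDomain, ← det_transpose, hbB]
  have : Countable (Submodule.span ℤ (Set.range b)).toAddSubgroup :=
    inferInstanceAs <| Countable (Submodule.span ℤ (Set.range b))
  obtain ⟨⟨x, hxL⟩, hx₀, hxs⟩ := exists_ne_zero_mem_lattice_of_measure_mul_two_pow_lt_measure
    (ZSpan.isAddFundamentalDomain' b volume) hsymm hconvex
    (by rwa [hfund, Module.finrank_fintype_fun_eq_card])
  obtain ⟨w, rfl⟩ := (Submodule.mem_span_range_iff_exists_fun ℤ).1 hxL
  refine ⟨w, fun hw => hx₀ (Subtype.ext (by simp [hw])), ?_⟩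
  convert hxs using 1
  ext i
  simp [hb, mulVec, dotProduct, realVec, mul_comm]

theorem volume_ball_le_of_one_le [DecidableEq ι] {B : Matrix ι ι ℝ} (hB : IsUnit B.det)
    (h : ∀ w : ι → ℤ, w ≠ 0 → 1 ≤ ∑ i, (B *ᵥ realVec w) i ^ 2) :
    volume.real (Metric.ball (0 : EuclideanSpace ℝ ι) 1) ≤ 2 ^ Fintype.card ι * |B.det| := by
  by_contra! hlt
  let s : Set (ι → ℝ) := WithLp.toLp 2 ⁻¹' Metric.ball (0 : EuclideanSpace ℝ ι) 1
  have hvol : volume s = volume (Metric.ball (0 : EuclideanSpace ℝ ι) 1) :=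
    (PiLp.volume_preserving_toLp ι).measure_preimage measurableSet_ball.nullMeasurableSet
  have hconvex : Convex ℝ s :=
    (convex_ball _ _).linear_preimage (WithLp.linearEquiv 2 ℝ (ι → ℝ)).symm.toLinearMap
  have hlt' : ENNReal.ofReal |B.det| * 2 ^ Fintype.card ι < volume s := by
    rw [hvol, ← ENNReal.toReal_lt_toReal (by finiteness) measure_ball_lt_top.ne]
    simpa [mul_comm, Measure.real] using hlt
  obtain ⟨w, hw₀, hws⟩ := exists_ne_zero_mulVec_realVec_mem hB
    (fun x hx => by simpa [s] using hx) hconvex hlt'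
  refine (h w hw₀).not_gt ?_
  simpa [s, EuclideanSpace.norm_eq, Real.sqrt_lt'] using hws

theorem sq_volume_ball_le_of_posDef [DecidableEq ι] {A : Matrix ι ι ℝ} (hA : A.PosDef)
    (h : ∀ w, w ≠ 0 → 1 ≤ value A w) :
    volume.real (Metric.ball (0 : EuclideanSpace ℝ ι) 1) ^ 2 ≤ 4 ^ Fintype.card ι * A.det := by
  obtain ⟨B, rfl⟩ := exists_eq_transpose_mul_self hA.posSemidef
  have hB : IsUnit B.det := (isUnit_iff_isUnit_det B).1 (isUnit_of_mul_isUnit_right hA.isUnit)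
  have key := volume_ball_le_of_one_le hB fun w hw => by
    rw [← dotProduct_transpose_mul_self_mulVec]
    exact h w hw
  calc _ ≤ (2 ^ Fintype.card ι * |B.det|) ^ 2 := pow_le_pow_left₀ measureReal_nonneg key 2
    _ = 4 ^ Fintype.card ι * (Bᵀ * B).det := by
      rw [mul_pow, sq_abs, ← pow_mul, mul_comm _ 2, pow_mul, det_mul, det_transpose, sq B.det]
      norm_num

theorem sq_volume_ball_le_of_posSemidef [DecidableEq ι] {A : Matrix ι ι ℝ} (hA : A.PosSemidef)
    (h : ∀ w, w ≠ 0 → 1 ≤ value A w) :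
    volume.real (Metric.ball (0 : EuclideanSpace ℝ ι) 1) ^ 2 ≤ 4 ^ Fintype.card ι * A.det := by
  have hcont : Continuous fun ε : ℝ => 4 ^ Fintype.card ι * (A + ε • (1 : Matrix ι ι ℝ)).det := by
    fun_prop
  have hlim := (hcont.tendsto 0).mono_left (nhdsWithin_le_nhds (s := Set.Ioi 0))
  rw [zero_smul, add_zero] at hlim
  refine ge_of_tendsto hlim ?_
  filter_upwards [self_mem_nhdsWithin] with ε (hε : 0 < ε)
  have hεI : (ε • (1 : Matrix ι ι ℝ)).PosDef := PosDef.one.smul hε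
  refine sq_volume_ball_le_of_posDef (hεI.posSemidef_add hA) fun w hw => ?_
  rw [value_add]
  exact (h w hw).trans (le_add_of_nonneg_right (value_nonneg hεI.posSemidef w))

theorem sq_volume_ball_mul_det_le [DecidableEq ι] {A B : Matrix ι ι ℝ} (hA : A.PosSemidef)
    (h : ∀ w, w ≠ 0 → 1 ≤ value A w) (hB : B.PosSemidef)
    (htrace : (A * B).trace ≤ Fintype.card ι) :
    volume.real (Metric.ball (0 : EuclideanSpace ℝ ι) 1) ^ 2 * B.det ≤ 4 ^ Fintype.card ι := by
  have hdet : A.det * B.det ≤ 1 :=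
    (det_mul_det_le_trace_mul_div_card_pow hA hB).trans <| pow_le_one₀
      (div_nonneg (trace_mul_nonneg hA hB) (Nat.cast_nonneg _))
      (div_le_one_of_le₀ htrace (Nat.cast_nonneg _))
  calc _ ≤ 4 ^ Fintype.card ι * A.det * B.det :=
      mul_le_mul_of_nonneg_right (sq_volume_ball_le_of_posSemidef hA h) hB.det_nonneg
    _ = 4 ^ Fintype.card ι * (A.det * B.det) := mul_assoc ..
    _ ≤ 4 ^ Fintype.card ι := mul_le_of_le_one_right (by positivity) hdet

end IntegralPoints

section Polyhedron

variable {n : ℕ}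

theorem IsPrimitive.ne_zero {w : Fin n → ℤ} (hw : IsPrimitive w) : w ≠ 0 := by
  rintro rfl
  exact zero_ne_one ((Finset.gcd_eq_zero_iff.2 fun _ _ => rfl).symm.trans hw)

theorem isPrimitive_smul_add_single (w : Fin n → ℤ) {i j : Fin n} (hij : i ≠ j) (k : ℤ) :
    IsPrimitive ((k * w i) • w + Pi.single j 1) := by
  rw [IsPrimitive, ← Finset.normalize_gcd, normalize_eq_one]
  have hk : IsCoprime (k * w i) (k * w i * w j + 1) := ⟨-w j, 1, by ring⟩
  have hw : IsCoprime (w i) (k * w i * w j + 1) := ⟨-(k * w j), 1, by ring⟩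
  refine (hk.mul_left hw).isUnit_of_dvd' ?_ ?_
  · have := Finset.gcd_dvd (f := (k * w i) • w + Pi.single j 1) (Finset.mem_univ i)
    rwa [Pi.add_apply, Pi.single_eq_of_ne hij, add_zero, Pi.smul_apply, smul_eq_mul] at this
  · have := Finset.gcd_dvd (f := (k * w i) • w + Pi.single j 1) (Finset.mem_univ j)
    rwa [Pi.add_apply, Pi.single_eq_same, Pi.smul_apply, smul_eq_mul] at this

theorem nonneg_of_forall_le_quadratic {K : Type*} [Field K] [LinearOrder K]
    [IsStrictOrderedRing K] [Archimedean K] {a b c m : K} (h : ∀ k : ℤ, m ≤ a * k ^ 2 + b * k + c) :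
    0 ≤ a := by
  by_contra! ha
  obtain ⟨k, hk⟩ := exists_nat_gt ((c - m) / -a)
  rw [div_lt_iff₀ (neg_pos.2 ha)] at hk
  have hkk : (k : K) ≤ k ^ 2 := mod_cast Nat.le_self_pow two_ne_zero k
  -- The linear terms at `k` and `-k` cancel.
  have hpos := h k
  have hneg := h (-k)
  push_cast at hpos hneg
  have hsq : a * k ^ 2 ≤ a * k := mul_le_mul_of_nonpos_left hkk ha.le
  linarith [neg_sq (k : K)]

theorem value_nonneg_of_forall_isPrimitive_le (hn : 2 ≤ n) {A : Matrix (Fin n) (Fin n) ℝ} {m : ℝ}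
    (h : ∀ w, IsPrimitive w → m ≤ value A w) (w : Fin n → ℤ) : 0 ≤ value A w := by
  obtain rfl | hw := eq_or_ne w 0
  · simp [value, realVec, dotProduct]
  obtain ⟨i, hi⟩ := Function.ne_iff.1 hw
  have : Nontrivial (Fin n) := Fin.nontrivial_iff_two_le.2 hn
  obtain ⟨j, hij⟩ := exists_ne i
  let e : Fin n → ℤ := Pi.single j 1
  -- On the primitive points `k wᵢ w + eⱼ` the form is a polynomial in `k`.
  have hquad : ∀ k : ℤ, m ≤ w i ^ 2 * value A w * k ^ 2 +
      w i * (realVec w ⬝ᵥ A *ᵥ realVec e + realVec e ⬝ᵥ A *ᵥ realVec w) * k + value A e :=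
    fun k => by
      have hk := h _ (isPrimitive_smul_add_single w hij.symm k)
      have hcast : realVec ((k * w i) • w + e) = ((k * w i : ℤ) : ℝ) • realVec w + realVec e := by
        ext l
        simp [realVec]
      rw [value, hcast] at hk
      simp only [mulVec_add, mulVec_smul, dotProduct_add, add_dotProduct, smul_dotProduct,
        dotProduct_smul, smul_eq_mul, Int.cast_mul] at hk
      simp only [value]
      linarith
  exact nonneg_of_mul_nonneg_right (nonneg_of_forall_le_quadratic hquad)
    (by have := Int.cast_ne_zero (α := ℝ).2 hi; positivity)

theorem le_value_of_ne_zero {A : Matrix (Fin n) (Fin n) ℝ} {m : ℝ} (hm : 0 ≤ m)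
    (h : ∀ w, IsPrimitive w → m ≤ value A w) {w : Fin n → ℤ} (hw : w ≠ 0) : m ≤ value A w := by
  obtain ⟨i, hi⟩ := Function.ne_iff.1 hw
  obtain ⟨u, hwu, hu⟩ := Finset.extract_gcd w ⟨i, Finset.mem_univ i⟩
  generalize Finset.univ.gcd w = g at hwu
  have hg : g ≠ 0 := by
    rintro rfl
    exact hi (by rw [hwu i (Finset.mem_univ i), zero_mul, Pi.zero_apply])
  have hg₁ : (1 : ℝ) ≤ g * g := mod_cast Int.add_one_le_iff.2 (mul_self_pos.2 hg)
  have hcast : realVec w = (g : ℝ) • realVec u := by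
    ext l
    simp [realVec, hwu l (Finset.mem_univ l)]
  calc m ≤ value A u := h u hu
    _ ≤ g * g * value A u := le_mul_of_one_le_left (hm.trans (h u hu)) hg₁
    _ = value A w := by
      rw [value, value, hcast, mulVec_smul, dotProduct_smul, smul_dotProduct, smul_smul,
        smul_eq_mul]

theorem trace_mul_q (A : Matrix (Fin n) (Fin n) ℝ) (w : Fin n → ℤ) :
    (A * q w).trace = value A w :=
  trace_mul_vecMulVec_self A (realVec w)

theorem posSemidef_q (w : Fin n → ℤ) : (q w).PosSemidef :=
  posSemidef_vecMulVec_self_star (realVec w)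

theorem q_mem_polyhedron {w : Fin n → ℤ} (hw : IsPrimitive w) : q w ∈ polyhedron n :=
  subset_closure (subset_convexHull ℝ _ ⟨w, hw, rfl⟩)

theorem polyhedron_subset {S : Set (Matrix (Fin n) (Fin n) ℝ)} (hconvex : Convex ℝ S)
    (hclosed : IsClosed S) (h : ∀ w, IsPrimitive w → q w ∈ S) : polyhedron n ⊆ S :=
  closure_minimal (convexHull_min (by rintro _ ⟨w, hw, rfl⟩; exact h w hw) hconvex) hclosed

theorem isSymm_of_mem_polyhedron {x : Matrix (Fin n) (Fin n) ℝ} (hx : x ∈ polyhedron n) :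
    x.IsSymm :=
  polyhedron_subset (symm n).convex (symm n).closed_of_finiteDimensional
    (fun _ _ => Matrix.IsSymm.ext fun _ _ => mul_comm _ _) hx

theorem le_trace_mul_of_mem_polyhedron {A : Matrix (Fin n) (Fin n) ℝ} {m : ℝ}
    (h : ∀ w, IsPrimitive w → m ≤ (A * q w).trace) {x : Matrix (Fin n) (Fin n) ℝ}
    (hx : x ∈ polyhedron n) : m ≤ (A * x).trace := by
  have hconvex : Convex ℝ {y : Matrix (Fin n) (Fin n) ℝ | m ≤ (A * y).trace} :=
    convex_halfSpace_ge (traceLinearMap (Fin n) ℝ ℝ ∘ₗ LinearMap.mulLeft ℝ A).isLinear m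
  have hclosed : IsClosed {y : Matrix (Fin n) (Fin n) ℝ | m ≤ (A * y).trace} :=
    isClosed_le continuous_const (by fun_prop)
  exact polyhedron_subset hconvex hclosed h hx

theorem posSemidef_of_mem_polyhedron {x : Matrix (Fin n) (Fin n) ℝ} (hx : x ∈ polyhedron n) :
    x.PosSemidef := by
  refine .of_dotProduct_mulVec_nonneg (isSymm_of_mem_polyhedron hx) fun y => ?_
  rw [star_trivial, ← trace_mul_vecMulVec_self, trace_mul_comm]
  refine le_trace_mul_of_mem_polyhedron (fun w _ => ?_) hx
  rw [trace_mul_comm, trace_mul_vecMulVec_self]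
  exact (posSemidef_q w).dotProduct_mulVec_nonneg y

end Polyhedron

section Cone

variable {n : ℕ}

theorem Cone.face_subset (σ : Cone n) : σ.face ⊆ polyhedron n := σ.isExposed.subset

theorem Cone.two_le (σ : Cone n) : 2 ≤ n := by
  by_contra! hn
  have : Subsingleton (Fin n) := Fin.subsingleton_iff_le_one.2 (Nat.le_of_lt_succ hn)
  have hsub : polyhedron n ⊆ {1} :=
    polyhedron_subset (convex_singleton 1) isClosed_singleton fun w hw => by
      ext i j
      obtain rfl := Subsingleton.elim i j
      have hi : IsUnit (w i) :=
        isUnit_of_dvd_one (hw ▸ Finset.dvd_gcd fun k _ => by rw [Subsingleton.elim i k])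
      rw [one_apply_eq, q, of_apply]
      exact mod_cast Int.isUnit_mul_self hi
  obtain ⟨x, hx⟩ := σ.nonempty
  refine σ.proper (σ.face_subset.antisymm fun y hy => ?_)
  rwa [hsub hy, ← hsub (σ.face_subset hx)]

theorem Cone.exists_isSymm_mem_face_iff (σ : Cone n) :
    ∃ A : Matrix (Fin n) (Fin n) ℝ, A.IsSymm ∧ ∀ x, x ∈ σ.face ↔
      x ∈ polyhedron n ∧ ∀ y ∈ polyhedron n, (A * x).trace ≤ (A * y).trace := by
  obtain ⟨l, hl⟩ := σ.isExposed σ.nonempty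
  obtain ⟨A, hA, hlA⟩ := exists_isSymm_forall_eq_trace_mul (-l.toLinearMap)
  refine ⟨A, hA, fun x => ?_⟩
  rw [hl]
  refine and_congr_right fun hx => forall₂_congr fun y hy => ?_
  rw [← hlA x (isSymm_of_mem_polyhedron hx), ← hlA y (isSymm_of_mem_polyhedron hy)]
  exact neg_le_neg_iff.symm

/-- The form with matrix `A` supports `Π` along the face generating `σ`: the functional
`x ↦ tr (A x)` attains its minimum over `Π` exactly on that face. The form is normalised to have
minimum `1`. -/
structure Cone.IsSupportingForm (σ : Cone n) (A : Matrix (Fin n) (Fin n) ℝ) : Prop where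
  posSemidef : A.PosSemidef
  one_le_value : ∀ w, w ≠ 0 → 1 ≤ value A w
  mem_face_iff : ∀ x, x ∈ σ.face ↔ x ∈ polyhedron n ∧ (A * x).trace = 1

theorem Cone.exists_isSupportingForm {σ : Cone n} {y : Matrix (Fin n) (Fin n) ℝ} (hy : y.PosDef)
    (hyσ : y ∈ σ.toSet) : ∃ A, σ.IsSupportingForm A := by
  obtain ⟨A, hAsymm, hA⟩ := σ.exists_isSymm_mem_face_iff
  obtain ⟨t, ht, x₀, hx₀, rfl⟩ := hyσ
  have hmin := ((hA x₀).1 hx₀).2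
  have hprim : ∀ w, IsPrimitive w → (A * x₀).trace ≤ value A w := fun w hw =>
    (hmin _ (q_mem_polyhedron hw)).trans_eq (trace_mul_q A w)
  have hpsd : A.PosSemidef :=
    posSemidef_of_forall_value_nonneg hAsymm (value_nonneg_of_forall_isPrimitive_le σ.two_le hprim)
  have hA₀ : A ≠ 0 := by
    rintro rfl
    refine σ.proper (σ.face_subset.antisymm fun x hx => (hA x).2 ⟨hx, fun y _ => ?_⟩)
    rw [Matrix.zero_mul, Matrix.zero_mul]
  have hm : 0 < (A * x₀).trace := by
    have := trace_mul_pos hpsd hA₀ hy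
    rw [Matrix.mul_smul, trace_smul] at this
    exact pos_of_mul_pos_right this ht
  refine ⟨(A * x₀).trace⁻¹ • A, hpsd.smul (inv_nonneg.2 hm.le), fun w hw => ?_, fun x => ?_⟩
  · rw [value_smul, ← div_eq_inv_mul, one_le_div₀ hm]
    exact le_value_of_ne_zero hm.le hprim hw
  · rw [hA, Matrix.smul_mul, trace_smul, smul_eq_mul, ← div_eq_inv_mul, div_eq_one_iff_eq hm.ne']
    refine and_congr_right fun hx => ⟨fun h => ?_, fun h y hy => h ▸ hmin y hy⟩
    exact (h x₀ (σ.face_subset hx₀)).antisymm (hmin x hx)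

namespace Cone.IsSupportingForm

variable {σ : Cone n} {A : Matrix (Fin n) (Fin n) ℝ}

theorem mem_vertices (hA : σ.IsSupportingForm A) {w : Fin n → ℤ} (hw : IsPrimitive w)
    (h : value A w = 1) : w ∈ σ.vertices :=
  ⟨hw, vecMulVec_self_mem_extremePoints (A := A) (u := realVec w)
    (fun _ hx => posSemidef_of_mem_polyhedron (σ.face_subset hx))
    (fun x hx => ((hA.mem_face_iff x).1 hx).2)
    ((hA.mem_face_iff _).2 ⟨q_mem_polyhedron hw, (trace_mul_q A w).trans h⟩)⟩

theorem posDef (hA : σ.IsSupportingForm A) : A.PosDef := by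
  refine hA.posSemidef.posDef_iff_det_ne_zero.2 fun hdet => ?_
  have hball := sq_volume_ball_le_of_posSemidef hA.posSemidef hA.one_le_value
  rw [hdet, mul_zero] at hball
  have : 0 < volume.real (Metric.ball (0 : EuclideanSpace ℝ (Fin n)) 1) :=
    ENNReal.toReal_pos (Metric.measure_ball_pos _ _ one_pos).ne' measure_ball_lt_top.ne
  exact hball.not_gt (pow_pos this 2)

theorem exists_forall_one_le_mul_value_sub_one (hA : σ.IsSupportingForm A) :
    ∃ L : ℝ, ∀ w, w ≠ 0 → value A w ≠ 1 → 1 ≤ L * (value A w - 1) := by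
  obtain ⟨K, hK⟩ := ((finite_setOf_value_le hA.posDef 2).image
    fun w => (value A w - 1)⁻¹).bddAbove
  refine ⟨max K 1, fun w hw hne => ?_⟩
  have hpos : 0 < value A w - 1 := sub_pos.2 ((hA.one_le_value w hw).lt_of_ne' hne)
  rw [← inv_le_iff_one_le_mul₀ hpos]
  rcases le_or_gt (value A w) 2 with hle | hgt
  · exact (hK ⟨w, hle, rfl⟩).trans (le_max_left K 1)
  · exact (inv_le_one_of_one_le₀ (by linarith)).trans (le_max_right K 1)

theorem one_le_trace_mul_of_mem_face (hA : σ.IsSupportingForm A) {C : Matrix (Fin n) (Fin n) ℝ}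
    (hC : C.PosSemidef) (h : ∀ w ∈ σ.vertices, 1 ≤ value C w) {x : Matrix (Fin n) (Fin n) ℝ}
    (hx : x ∈ σ.face) : 1 ≤ (C * x).trace := by
  obtain ⟨hx', hAx⟩ := (hA.mem_face_iff x).1 hx
  obtain ⟨L, hgap⟩ := hA.exists_forall_one_le_mul_value_sub_one
  -- Off the minimal points of `A` the gap, scaled by `L`, makes up for `C` being small there.
  have hle : 1 + L ≤ ((C + L • A) * x).trace := by
    refine le_trace_mul_of_mem_polyhedron (fun w hw => ?_) hx'
    rw [trace_mul_q, value_add, value_smul]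
    by_cases hw₁ : value A w = 1
    · rw [hw₁, mul_one]
      exact add_le_add_left (h w (hA.mem_vertices hw hw₁)) L
    · linarith [hgap w hw.ne_zero hw₁, value_nonneg hC w]
  rw [Matrix.add_mul, trace_add, Matrix.smul_mul, trace_smul, hAx, smul_eq_mul, mul_one] at hle
  exact le_of_add_le_add_right hle

theorem trace_mul_le_trace_mul_of_mem_toSet (hA : σ.IsSupportingForm A)
    {C : Matrix (Fin n) (Fin n) ℝ} (hC : C.PosSemidef) (h : ∀ w ∈ σ.vertices, 1 ≤ value C w)
    {y : Matrix (Fin n) (Fin n) ℝ} (hy : y ∈ σ.toSet) : (A * y).trace ≤ (C * y).trace := by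
  obtain ⟨t, ht, x, hx, rfl⟩ := hy
  rw [Matrix.mul_smul, Matrix.mul_smul, trace_smul, trace_smul, ((hA.mem_face_iff x).1 hx).2]
  exact mul_le_mul_of_nonneg_left (hA.one_le_trace_mul_of_mem_face hC h hx) ht

end Cone.IsSupportingForm

end Cone

namespace ModularSymbol

variable {n : ℕ} (v : ModularSymbol n)

/-- The matrix `(v₁, …, vₙ)` with columns `vᵢ`, with entries viewed in the ring `R`. -/
def matrix (R : Type*) [IntCast R] : Matrix (Fin n) (Fin n) R :=
  of fun i j => (v.vec j i : R)

theorem det_matrix (R : Type*) [CommRing R] : (v.matrix R).det = ((v.matrix ℤ).det : R) := by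
  rw [Int.cast_det]; rfl

theorem isUnit_det_matrix (K : Type*) [Field K] [CharZero K] (hv : v.norm ≠ 0) :
    IsUnit (v.matrix K).det := by
  rw [det_matrix, isUnit_iff_ne_zero, Int.cast_ne_zero]
  exact fun h => hv (abs_eq_zero.2 h)

theorem b_eq_matrix_mul_transpose : v.b = v.matrix ℝ * (v.matrix ℝ)ᵀ := by
  ext i j
  simp [b, Matrix.sum_apply, q, mul_apply, matrix]

theorem det_b : v.b.det = (v.norm : ℝ) ^ 2 := by
  rw [b_eq_matrix_mul_transpose, det_mul, det_transpose, det_matrix, ← sq, ← sq_abs, ← Int.cast_abs]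
  rfl

theorem posDef_b (hv : v.norm ≠ 0) : v.b.PosDef := by
  have hpsd : v.b.PosSemidef := by
    rw [b_eq_matrix_mul_transpose]
    exact posSemidef_self_mul_conjTranspose (v.matrix ℝ)
  refine hpsd.posDef_iff_det_ne_zero.2 ?_
  rw [det_b]
  exact pow_ne_zero 2 (Int.cast_ne_zero.2 hv)

variable {v}

theorem one_le_value_inv_b (hv : v.norm ≠ 0) {w : Fin n → ℤ} (hw : w ≠ 0) (hc : w ∉ v.cand) :
    1 ≤ value v.b⁻¹ w := by
  obtain ⟨c, hwc⟩ : ∃ c : Fin n → ℚ, v.matrix ℚ *ᵥ c = fun i => (w i : ℚ) :=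
    ⟨(v.matrix ℚ)⁻¹ *ᵥ fun i => (w i : ℚ), by
      rw [mulVec_mulVec, mul_nonsing_inv _ (v.isUnit_det_matrix ℚ hv), one_mulVec]⟩
  have hwc' : ∀ k, (w k : ℚ) = ∑ i, c i * (v.vec i k : ℚ) := fun k => by
    rw [← congrFun hwc k]
    exact dotProduct_comm _ _
  have hreal : realVec w = v.matrix ℝ *ᵥ fun i => (c i : ℝ) := by
    ext k
    have := congrArg (Rat.cast : ℚ → ℝ) (hwc' k)
    push_cast at this
    exact this.trans (dotProduct_comm _ _)
  obtain ⟨i, hi⟩ : ∃ i, 1 ≤ |c i| := by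
    by_contra! hlt
    exact hc ⟨hw, c, fun i => ⟨abs_nonneg _, hlt i⟩, hwc'⟩
  rw [value, hreal, b_eq_matrix_mul_transpose,
    dotProduct_inv_mul_transpose_mulVec (v.isUnit_det_matrix ℝ hv)]
  have hi' : 1 ≤ c i * c i := by rwa [← sq, one_le_sq_iff_one_le_abs]
  calc (1 : ℝ) ≤ c i * c i := mod_cast hi'
    _ ≤ ∑ j, (c j : ℝ) * c j :=
      Finset.single_le_sum (f := fun j => (c j : ℝ) * c j) (fun _ _ => mul_self_nonneg _)
        (Finset.mem_univ i)

end ModularSymbol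

theorem two_pow_lt_volume_ball_mul_two {n : ℕ} (hn : n = 2 ∨ n = 3) :
    2 ^ n < volume.real (Metric.ball (0 : EuclideanSpace ℝ (Fin n)) 1) * 2 := by
  have := Real.pi_gt_three
  rcases hn with rfl | rfl
  · rw [Measure.real, EuclideanSpace.volume_ball_fin_two, ENNReal.toReal_mul,
      ENNReal.toReal_pow, ENNReal.toReal_ofReal Real.pi_nonneg, ENNReal.toReal_ofReal zero_le_one]
    linarith
  · rw [Measure.real, EuclideanSpace.volume_ball_fin_three, ENNReal.toReal_mul,
      ENNReal.toReal_pow, ENNReal.toReal_ofReal zero_le_one, ENNReal.toReal_ofReal (by positivity)]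
    linarith

end Voronoi

open Matrix MeasureTheory Voronoi in
theorem theorem3p9_general {n : ℕ} (v : ModularSymbol n)
    (hv : 2 ^ n < volume.real (Metric.ball (0 : EuclideanSpace ℝ (Fin n)) 1) * v.norm)
    (σ : Cone n) (hb : v.b ∈ σ.toSet) : (v.cand ∩ σ.vertices).Nonempty := by
  have hv₀ : v.norm ≠ 0 := fun h => hv.not_ge (by simp [h])
  have hbpos := v.posDef_b hv₀
  obtain ⟨A, hA⟩ := Cone.exists_isSupportingForm hbpos hb
  by_contra hempty
  have hcand : ∀ w ∈ σ.vertices, 1 ≤ value v.b⁻¹ w := fun w hw =>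
    ModularSymbol.one_le_value_inv_b hv₀ hw.1.ne_zero fun hc => hempty ⟨w, hc, hw⟩
  have htrace : (A * v.b).trace ≤ Fintype.card (Fin n) := by
    refine (hA.trace_mul_le_trace_mul_of_mem_toSet hbpos.inv.posSemidef hcand hb).trans_eq ?_
    rw [nonsing_inv_mul _ hbpos.det_pos.ne'.isUnit, trace_one]
  have hball := sq_volume_ball_mul_det_le hA.posSemidef hA.one_le_value hbpos.posSemidef htrace
  refine hv.not_ge (le_of_sq_le_sq ?_ (by positivity))
  rw [v.det_b, Fintype.card_fin, ← mul_pow] at hball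
  exact hball.trans_eq (by rw [pow_right_comm]; norm_num)

theorem theorem3p9 (n : ℕ) (hn : n = 2 ∨ n = 3) (v : Voronoi.ModularSymbol n)
    (hv : 1 < v.norm) (σ : Voronoi.Cone n) (hσ : σ.IsTop) (hb : v.b ∈ σ.toSet) :
    (v.cand ∩ σ.vertices).Nonempty :=
  theorem3p9_general v ((Voronoi.two_pow_lt_volume_ball_mul_two hn).trans_le
    (by gcongr; exact mod_cast hv)) σ hb
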